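/- Let $C_n$ be the set of real $n\times n$ companion matrices whose $i$-th row, for $1\le i\le n-1$, has a $1$ in column $i+1$ and zeros elsewhere, and whose last row is an arbitrary $(0,1)$-vector. Let $\mathcal{PSC}_n^{1,0}$ be the set of all primitive matrices of the form $A+A^T$ with $A=(a_{ij})\in C_n$, $a_{n1}=1$ and $a_{nn}=0$. (A nonnegative square matrix $B$ is primitive if $B^k$ is entrywise positive for some $k\ge 1$; the least such $k$ is its exponent $\exp(B)$.) Let $b$ be the largest even integer in $[2,n-1]$. If $n\ge 5$ is odd or $n\ge 8$ is even, then $b$ is the maximum of the exponents of the matrices in $\mathcal{PSC}_n^{1,0}$, and the number of matrices $B\in\mathcal{PSC}_n^{1,0}$ with $\exp(B)=b$ is $$N_n^{1,0}(b)=\begin{cases}2(2n-7) & \text{if } n\ge 5 \text{ is odd},\\ 18 & \text{if } n\ge 8 \text{ is even}.\end{cases}$$ -/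

import Mathlib

namespace SymmCompanion

/-- The companion matrix whose first `n - 1` rows have a single `1` just right of the diagonal
and whose last row is `a`. -/
def companion {n : ℕ} (a : Fin n → ℝ) : Matrix (Fin n) (Fin n) ℝ :=
  Matrix.of fun i j =>
    if (i : ℕ) + 1 = n then a j else if (j : ℕ) = (i : ℕ) + 1 then 1 else 0

/-- `C_n`: the set of all `(0,1)` companion matrices of order `n`. -/
def zeroOneCompanion (n : ℕ) : Set (Matrix (Fin n) (Fin n) ℝ) :=
  {A | ∃ a : Fin n → ℝ, (∀ j, a j = 0 ∨ a j = 1) ∧ A = companion a}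

/-- `F(A) = A + Aᵀ`. -/
def symmetrization {n : ℕ} (A : Matrix (Fin n) (Fin n) ℝ) : Matrix (Fin n) (Fin n) ℝ :=
  A + A.transpose

/-- `C_n^{α,ε}`: the symmetric companion matrices `F(A)` with `A ∈ C_n`, `a_{n1} = α` and
`a_{nn} = ε` (entries of `A`; the indices here start at `0`). -/
def symmCompanion (n : ℕ) (α ε : ℝ) : Set (Matrix (Fin n) (Fin n) ℝ) :=
  {B | ∃ A ∈ zeroOneCompanion n,
    (∀ i j : Fin n, (i : ℕ) + 1 = n → (j : ℕ) = 0 → A i j = α) ∧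
    (∀ i : Fin n, (i : ℕ) + 1 = n → A i i = ε) ∧
    B = symmetrization A}

/-- `PSC_n^{α,ε}`: the primitive matrices in `C_n^{α,ε}`. -/
def primSymmCompanion (n : ℕ) (α ε : ℝ) : Set (Matrix (Fin n) (Fin n) ℝ) :=
  {B | B ∈ symmCompanion n α ε ∧ B.IsPrimitive}

/-- The primitive exponent: the smallest positive `k` for which `A ^ k` is entrywise positive.
(Only meaningful for primitive matrices.) -/
noncomputable def primitiveExponent {n : ℕ} (A : Matrix (Fin n) (Fin n) ℝ) : ℕ :=
  sInf {k : ℕ | 0 < k ∧ ∀ i j, 0 < (A ^ k) i j}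

/-- The exponent set `E(X)` of a set of matrices. -/
def exponentSet {n : ℕ} (X : Set (Matrix (Fin n) (Fin n) ℝ)) : Set ℕ :=
  {k | ∃ A ∈ X, A.IsPrimitive ∧ primitiveExponent A = k}

/-- `N_n^{α,ε}(b)`: the number of matrices in `PSC_n^{α,ε}` with exponent `b`. -/
noncomputable def numWithExponent (n : ℕ) (α ε : ℝ) (b : ℕ) : ℕ :=
  Set.ncard {A : Matrix (Fin n) (Fin n) ℝ |
    A ∈ primSymmCompanion n α ε ∧ primitiveExponent A = b}

/-- `[a, b]^e`: the even integers in `[a, b]`. -/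
def evenInterval (a b : ℕ) : Set ℕ := {k | a ≤ k ∧ k ≤ b ∧ Even k}

end SymmCompanion

namespace SymmCompanion

/-! Put D = n - 2. The support of the matrix is a graph: a path 0, …, D and a hub D + 1 joined to
both ends and to an arbitrary set T of interior vertices. The remaining free entry of the last row,
in column D, only turns a 1 into a 2, so each graph comes from two matrices; hence the factor 2 in
both counts. The exponent is the least k > 0 such that any two vertices are joined by a walk of
length k. Walks can be lengthened by 2 (`Walk.extend`), so only parities and upper bounds of lengths
matter.

For D odd, the cycle through all vertices has odd length D + 2, and its arcs give walks of length D
+ 1 between all pairs and of length D between distinct vertices. For D even, the graph is bipartite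
unless T has an odd element; such an element gives walks of length D between all pairs and, if D ≥
6, of length D - 1 except possibly from a path vertex to itself. So the exponent is extremal exactly
when some vertex has no closed walk of the odd length D or D - 1.

Short odd closed walks are found in `walk_self_of_odd` and `walk_self_of_even` by passing through
the hub or circling an odd cycle; these fail only for the listed sets T. There are 1 + (D - 1) + (D
- 3) = 2n - 7 of them for D odd and nine for D even. For the listed sets, `not_walk_of_level`
excludes such walks at a chosen vertex. -/

/-- Adjacency in the graph on `0, …, D + 1` formed by the path `0, …, D` and the hub `D + 1`,
which is joined to `0`, to `D` and to the elements of `T`. -/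
def Adj (D : ℕ) (T : Finset ℕ) (x y : ℕ) : Prop :=
  (x + 1 = y ∧ y ≤ D) ∨ (y + 1 = x ∧ x ≤ D) ∨
    (x = D + 1 ∧ y ≤ D ∧ (y = 0 ∨ y = D ∨ y ∈ T)) ∨
    (y = D + 1 ∧ x ≤ D ∧ (x = 0 ∨ x = D ∨ x ∈ T))

/-- There is a walk of length `k` from `x` to `y`. -/
def Walk (D : ℕ) (T : Finset ℕ) : ℕ → ℕ → ℕ → Prop
  | 0, x, y => x = y ∧ x ≤ D + 1
  | k + 1, x, y => ∃ z, Walk D T k x z ∧ Adj D T z y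

/-! ### Elementary walks and padding -/

variable {D : ℕ} {T : Finset ℕ} {k l x y u s t p : ℕ}

theorem Adj.symm (h : Adj D T x y) : Adj D T y x := by
  unfold Adj at *
  tauto

theorem Adj.le_right (h : Adj D T x y) : y ≤ D + 1 := by
  unfold Adj at h
  omega

theorem Adj.le_left (h : Adj D T x y) : x ≤ D + 1 := h.symm.le_right

theorem Walk.le_left : ∀ {k y : ℕ}, Walk D T k x y → x ≤ D + 1
  | 0, _, h => h.2
  | _ + 1, _, ⟨_, h, _⟩ => h.le_left

theorem Walk.trans (h : Walk D T k x y) : ∀ {l z : ℕ}, Walk D T l y z → Walk D T (k + l) x z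
  | 0, _, h' => h'.1 ▸ h
  | _ + 1, _, ⟨w, h', e⟩ => ⟨w, h.trans h', e⟩

theorem Adj.walk (h : Adj D T x y) : Walk D T 1 x y := ⟨x, ⟨rfl, h.le_left⟩, h⟩

theorem Walk.symm : ∀ {k y : ℕ}, Walk D T k x y → Walk D T k y x
  | 0, _, h => ⟨h.1.symm, h.1 ▸ h.2⟩
  | k + 1, _, ⟨_, h, e⟩ => by
    rw [add_comm]
    exact e.symm.walk.trans h.symm

theorem exists_adj (hD : 1 ≤ D) (hx : x ≤ D + 1) : ∃ y, Adj D T y x := by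
  unfold Adj
  rcases Nat.lt_trichotomy x D with h | h | h
  · exact ⟨x + 1, by omega⟩
  · exact ⟨x - 1, by omega⟩
  · exact ⟨0, by omega⟩

theorem Walk.le_right (h : Walk D T k x y) : y ≤ D + 1 := h.symm.le_left

theorem Walk.extend (hD : 1 ≤ D) (h : Walk D T k x y) (hkl : k ≤ l) (hp : k % 2 = l % 2) :
    Walk D T l x y := by
  obtain ⟨m, rfl⟩ : ∃ m, l = k + 2 * m := ⟨(l - k) / 2, by omega⟩
  clear hkl hp
  induction m with
  | zero => exact h
  | succ m ih =>
    obtain ⟨z, hz⟩ := exists_adj (T := T) hD ih.le_right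
    exact ⟨z, ⟨y, ih, hz.symm⟩, hz⟩

theorem walk_up (hy : x + k ≤ D) : Walk D T k x (x + k) := by
  induction k with
  | zero => exact ⟨rfl, by omega⟩
  | succ k ih => exact ⟨x + k, ih (by omega), Or.inl ⟨by omega, by omega⟩⟩

/-- In truncated subtraction the length is |x - y|; this form keeps all later length estimates
within linear arithmetic. -/
theorem walk_path (hx : x ≤ D) (hy : y ≤ D) : Walk D T ((x - y) + (y - x)) x y := by
  rcases le_total x y with h | h
  · obtain ⟨m, rfl⟩ := Nat.exists_eq_add_of_le h
    have := walk_up (T := T) (x := x) (k := m) hy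
    convert this using 1
    omega
  · obtain ⟨m, rfl⟩ := Nat.exists_eq_add_of_le h
    have := (walk_up (T := T) (x := y) (k := m) hx).symm
    convert this using 1
    omega

/-! ### Walks through the hub -/

/-- The hub is adjacent to `x`. -/
def IsHubNeighbor (D : ℕ) (T : Finset ℕ) (x : ℕ) : Prop := x ≤ D ∧ (x = 0 ∨ x = D ∨ x ∈ T)

theorem isHubNeighbor_zero : IsHubNeighbor D T 0 := ⟨by omega, by simp⟩

theorem isHubNeighbor_last : IsHubNeighbor D T D := ⟨le_rfl, by simp⟩

theorem isHubNeighbor_of_mem (hT : T ⊆ Finset.Icc 1 (D - 1)) (hs : s ∈ T) :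
    IsHubNeighbor D T s :=
  ⟨by have := Finset.mem_Icc.1 (hT hs); omega, by simp [hs]⟩

theorem walk_to_hub (hx : x ≤ D) (hs : IsHubNeighbor D T s) :
    Walk D T ((x - s) + (s - x) + 1) x (D + 1) :=
  (walk_path hx hs.1).trans (Adj.walk (Or.inr (Or.inr (Or.inr ⟨rfl, hs.1, hs.2⟩))))

/-- The walk `x → s → hub → t → y`. -/
theorem walk_through_hub (hx : x ≤ D) (hy : y ≤ D) (hs : IsHubNeighbor D T s)
    (ht : IsHubNeighbor D T t) :
    Walk D T (((x - s) + (s - x) + 1) + ((y - t) + (t - y) + 1)) x y :=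
  (walk_to_hub hx hs).trans (walk_to_hub hy ht).symm

/-- The closed walk at the hub through the path between `s` and `t`. -/
theorem walk_hub_hub (hs : IsHubNeighbor D T s) (ht : IsHubNeighbor D T t) :
    Walk D T ((s - t) + (t - s) + 2) (D + 1) (D + 1) := by
  have := (walk_to_hub hs.1 ht).symm.trans (walk_to_hub hs.1 hs)
  convert this using 1
  omega

/-- The closed walk from `x` via `p` to the hub, around the cycle through `s` and `t`, and back. -/
theorem walk_lollipop (hx : x ≤ D) (hp : IsHubNeighbor D T p) (hs : IsHubNeighbor D T s)
    (ht : IsHubNeighbor D T t) :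
    Walk D T (2 * ((x - p) + (p - x)) + ((s - t) + (t - s)) + 4) x x := by
  have := ((walk_to_hub hx hp).trans (walk_hub_hub hs ht)).trans (walk_to_hub hx hp).symm
  convert this using 1
  omega

/-- A level function bounds from below the length of closed odd walks. -/
theorem not_walk_of_level (f : ℕ → ℕ) (m : ℕ) (hu : f u = 0)
    (hpath : ∀ x < D, f x + 1 = f (x + 1) ∨ f (x + 1) + 1 = f x ∨ (f x = f (x + 1) ∧ m ≤ f x))
    (hhub : ∀ x, x = 0 ∨ x = D ∨ x ∈ T →
      f x + 1 = f (D + 1) ∨ f (D + 1) + 1 = f x ∨ (f x = f (D + 1) ∧ m ≤ f x))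
    (hk : k % 2 = 1) (hkm : k ≤ 2 * m) : ¬ Walk D T k u u := by
  -- Until a level edge is used, f has the parity of the length. Such an edge has height at least m
  -- and takes at least m steps to reach, so afterwards j + f y ≥ 2m + 1, and no step lowers this
  -- sum.
  have key : ∀ j y, Walk D T j u y → f y ≤ j ∧ (f y % 2 = j % 2 ∨ 2 * m + 1 ≤ j + f y) := by
    intro j
    induction j with
    | zero =>
      rintro y ⟨rfl, -⟩
      omega
    | succ j ih =>
      rintro y ⟨z, hz, e⟩
      have h1 := ih z hz
      rcases e with ⟨rfl, h⟩ | ⟨rfl, h⟩ | ⟨rfl, -, h⟩ | ⟨rfl, -, h⟩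
      · have := hpath z (by omega)
        omega
      · have := hpath y (by omega)
        omega
      · have := hhub y h
        omega
      · have := hhub z h
        omega
  intro h
  have := key k u h
  omega

/-! ### Odd path length -/

/-- The two arcs between x and y on the cycle of odd length D + 2 have opposite parities; the even
one has length at most D + 1. -/
theorem walk_succ_of_odd (hD : 1 ≤ D) (ho : D % 2 = 1) (hx : x ≤ D + 1) (hy : y ≤ D + 1) :
    Walk D T (D + 1) x y := by
  have h0 := isHubNeighbor_zero (D := D) (T := T)
  have h1 := isHubNeighbor_last (D := D) (T := T)
  wlog hxy : x ≤ y generalizing x y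
  · exact (this hy hx (by omega)).symm
  rcases Nat.lt_or_ge D y with h | h
  · obtain rfl : y = D + 1 := by omega
    rcases Nat.lt_or_ge D x with h' | h'
    · obtain rfl : x = D + 1 := by omega
      exact (walk_hub_hub h0 h0).extend hD (by omega) (by omega)
    · rcases Nat.mod_two_eq_zero_or_one x with e | e
      · exact (walk_to_hub h' h1).extend hD (by omega) (by omega)
      · exact (walk_to_hub h' h0).extend hD (by omega) (by omega)
  · have h' : x ≤ D := by omega
    by_cases e : (y - x) % 2 = 0
    · exact (walk_path h' h).extend hD (by omega) (by omega)
    · exact (walk_through_hub h' h h0 h1).extend hD (by omega) (by omega)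

theorem walk_of_odd_of_ne (hD : 1 ≤ D) (ho : D % 2 = 1) (hx : x ≤ D + 1) (hy : y ≤ D + 1)
    (hxy : x ≠ y) : Walk D T D x y := by
  have h0 := isHubNeighbor_zero (D := D) (T := T)
  have h1 := isHubNeighbor_last (D := D) (T := T)
  wlog hxy : x ≤ y generalizing x y
  · exact (this hy hx (by omega) (by omega)).symm
  rcases Nat.lt_or_ge D y with h | h
  · obtain rfl : y = D + 1 := by omega
    have h' : x ≤ D := by omega
    rcases Nat.mod_two_eq_zero_or_one x with e | e
    · exact (walk_to_hub h' h0).extend hD (by omega) (by omega)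
    · exact (walk_to_hub h' h1).extend hD (by omega) (by omega)
  · have h' : x ≤ D := by omega
    by_cases e : (y - x) % 2 = 0
    · exact (walk_through_hub h' h h0 h1).extend hD (by omega) (by omega)
    · exact (walk_path h' h).extend hD (by omega) (by omega)

/-- The neighbourhoods of the hub that give the extremal exponent for odd path length. -/
def oddExtremal (D : ℕ) : Finset (Finset ℕ) :=
  {∅} ∪ (Finset.Icc 1 (D - 1)).image (fun s => {s}) ∪
    (Finset.Icc 1 (D - 3)).image (fun s => {s, s + 2})

theorem mem_oddExtremal : T ∈ oddExtremal D ↔ T = ∅ ∨ (∃ s, 1 ≤ s ∧ s ≤ D - 1 ∧ T = {s}) ∨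
    ∃ s, 1 ≤ s ∧ s ≤ D - 3 ∧ T = {s, s + 2} := by
  simp only [oddExtremal, Finset.mem_union, Finset.mem_singleton, Finset.mem_image,
    Finset.mem_Icc, or_assoc, and_assoc, eq_comm (a := T)]

theorem card_oddExtremal (hD : 3 ≤ D) : (oddExtremal D).card = 2 * D - 3 := by
  unfold oddExtremal
  rw [Finset.card_union_of_disjoint, Finset.card_union_of_disjoint, Finset.card_image_of_injective,
    Finset.card_image_of_injective]
  · simp
    omega
  · intro a b h
    have h1 := Finset.ext_iff.1 h a
    have h2 := Finset.ext_iff.1 h b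
    simp at h1 h2
    omega
  · exact Finset.singleton_injective
  · simp
  · rw [Finset.disjoint_left]
    intro A h1 h2
    simp only [Finset.mem_union, Finset.mem_singleton, Finset.mem_image, Finset.mem_Icc] at h1 h2
    obtain ⟨s, -, rfl⟩ := h2
    have h3 : ({s, s + 2} : Finset ℕ).card = 2 := Finset.card_pair (by omega)
    rcases h1 with h1 | ⟨r, -, h1⟩
    · simp [h1] at h3
    · simp [← h1] at h3

theorem walk_self_of_odd (hT : T ⊆ Finset.Icc 1 (D - 1)) (hD : 1 ≤ D) (ho : D % 2 = 1)
    (hE : T ∉ oddExtremal D) (hu : u ≤ D + 1) : Walk D T D u u := by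
  have h0 := isHubNeighbor_zero (D := D) (T := T)
  have h1 := isHubNeighbor_last (D := D) (T := T)
  rw [mem_oddExtremal] at hE
  push Not at hE
  obtain ⟨hne, hE1, hE2⟩ := hE
  have hb : ∀ s ∈ T, 1 ≤ s ∧ s ≤ D - 1 := fun s hs => Finset.mem_Icc.1 (hT hs)
  have hn : ∀ s ∈ T, IsHubNeighbor D T s := fun s hs => isHubNeighbor_of_mem hT hs
  obtain ⟨r, hr⟩ : T.Nonempty := hne
  rcases Nat.lt_or_ge D u with h | h
  · obtain rfl : u = D + 1 := by omega
    have := hb r hr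
    rcases Nat.mod_two_eq_zero_or_one r with e | e
    · exact (walk_hub_hub (hn r hr) h1).extend hD (by omega) (by omega)
    · exact (walk_hub_hub (hn r hr) h0).extend hD (by omega) (by omega)
  by_cases hc1 : ∃ s ∈ T, u ≤ s ∧ s % 2 = 1
  · obtain ⟨s, hs, hus, e⟩ := hc1
    have := hb s hs
    exact (walk_through_hub h h (hn s hs) h0).extend hD (by omega) (by omega)
  by_cases hc2 : ∃ s ∈ T, s ≤ u ∧ s % 2 = 0
  · obtain ⟨s, hs, hus, e⟩ := hc2
    have := hb s hs
    exact (walk_through_hub h h (hn s hs) h1).extend hD (by omega) (by omega)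
  push Not at hc1 hc2
  by_cases hc3 : ∃ s ∈ T, ∃ t ∈ T, s < u ∧ u < t
  · obtain ⟨s, hs, t, ht, hsu, hut⟩ := hc3
    have := hb s hs
    have := hb t ht
    have := hc1 t ht (by omega)
    have := hc2 s hs (by omega)
    exact (walk_through_hub h h (hn s hs) (hn t ht)).extend hD (by omega) (by omega)
  push Not at hc3
  have hTne : T.Nonempty := ⟨r, hr⟩
  set a := T.min' hTne with ha
  set c := T.max' hTne with hc
  have haT : a ∈ T := T.min'_mem hTne
  have hcT : c ∈ T := T.max'_mem hTne
  have hac : ∀ w ∈ T, a ≤ w ∧ w ≤ c := fun w hw => ⟨T.min'_le w hw, T.le_max' w hw⟩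
  have hba := hb a haT
  have hbc := hb c hcT
  -- By now T lies strictly on one side of u: all its elements are even and above u, or all are odd
  -- and below u.
  have hpar : ∀ w ∈ T, w % 2 = a % 2 := by
    intro w hw
    have e1 := hc1 w hw
    have e2 := hc2 w hw
    have e3 := hc1 a haT
    have e4 := hc2 a haT
    have e5 := hc3 a haT w hw
    have e6 := hac w hw
    omega
  have hfar : a + 4 ≤ c := by
    by_contra hlt
    have := hpar c hcT
    have := (hac c hcT).1
    rcases (by omega : c = a ∨ c = a + 2) with e | e
    · refine hE1 a hba.1 hba.2 (Finset.ext fun w => ?_)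
      rw [Finset.mem_singleton]
      refine ⟨fun hw => ?_, fun hw => hw ▸ haT⟩
      have := hac w hw
      omega
    · refine hE2 a hba.1 (by omega) (Finset.ext fun w => ?_)
      rw [Finset.mem_insert, Finset.mem_singleton]
      refine ⟨fun hw => ?_, ?_⟩
      · have := hac w hw
        have := hpar w hw
        omega
      · rintro (rfl | rfl)
        · exact haT
        · exact e ▸ hcT
  have e1 := hc1 a haT
  have e2 := hc2 a haT
  have e3 := hc1 c hcT
  have e4 := hc2 c hcT
  have e5 := hc3 a haT c hcT
  have e6 := hpar c hcT
  rcases Nat.lt_or_ge u a with hua | hua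
  -- The cycle hub, c, …, D is odd. If reaching it via 0 takes too long, parity gives 2u ≥ c - 2 ≥ a
  -- + 2, so the closed walk through a and D, of length D + a - 2u + 2, is short enough.
  · by_cases q1 : 2 * u + (D - c) + 4 ≤ D
    · exact (walk_lollipop h h0 (hn c hcT) h1).extend hD (by omega) (by omega)
    by_cases q2 : 2 * (a - u) + (D - c) + 4 ≤ D
    · exact (walk_lollipop h (hn a haT) (hn c hcT) h1).extend hD (by omega) (by omega)
    exact (walk_through_hub h h (hn a haT) h1).extend hD (by omega) (by omega)
  · by_cases q1 : 2 * (D - u) + a + 4 ≤ D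
    · exact (walk_lollipop h h1 (hn a haT) h0).extend hD (by omega) (by omega)
    by_cases q2 : 2 * (u - c) + a + 4 ≤ D
    · exact (walk_lollipop h (hn c hcT) (hn a haT) h0).extend hD (by omega) (by omega)
    exact (walk_through_hub h h (hn c hcT) h0).extend hD (by omega) (by omega)

theorem exists_not_walk_of_odd (hD : 1 ≤ D) (ho : D % 2 = 1) (hE : T ∈ oddExtremal D) :
    ∃ u ≤ D + 1, ¬ Walk D T D u u := by
  rw [mem_oddExtremal] at hE
  obtain ⟨q, rfl⟩ : ∃ q, D = 2 * q + 1 := ⟨D / 2, by omega⟩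
  rcases hE with rfl | ⟨s, hs1, hs2, rfl⟩ | ⟨s, hs1, hs2, rfl⟩
  -- The graph is a cycle of length 2q + 3; its only level edge lies opposite 0, at height q + 1.
  · refine ⟨0, by omega, not_walk_of_level (fun x => min x (2 * q + 3 - x)) (q + 1) ?_ ?_ ?_ ho
      (by omega)⟩
    · simp
    · intro x hx
      omega
    · intro x hx
      simp only [Finset.notMem_empty, or_false] at hx ⊢
      omega
  · rcases Nat.even_or_odd' s with ⟨m, rfl | rfl⟩
    -- Here u is the middle of 0, …, s, on the even cycle through the hub; the other cycle, through
    -- s, …, D, is odd with its level edge at height q + 1. For odd s, u is the middle of s, …, D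
    -- instead.
    · refine ⟨m, by omega, not_walk_of_level (fun x => if x ≤ 2 * m then (x - m) + (m - x)
        else if x ≤ 2 * q + 1 then min (x - m) (m + 3 + 2 * q - x) else m + 1)
        (q + 1) ?_ ?_ ?_ ho (by omega)⟩
      · split_ifs <;> omega
      · intro x hx
        split_ifs <;> omega
      · intro x hx
        simp only [Finset.mem_singleton] at hx
        rcases hx with rfl | rfl | rfl <;> split_ifs <;> omega
    · obtain ⟨r, rfl⟩ := Nat.exists_eq_add_of_le (show m ≤ q by omega)
      refine ⟨2 * m + 1 + r, by omega, not_walk_of_level (fun x => if x < 2 * m + 1 then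
        min (r + (2 * m + 1 - x)) (r + 2 + x) else if x ≤ 2 * (m + r) + 1 then
        (x - (2 * m + 1 + r)) + ((2 * m + 1 + r) - x) else r + 1)
        (m + r + 1) ?_ ?_ ?_ ho (by omega)⟩
      · split_ifs <;> omega
      · intro x hx
        split_ifs <;> omega
      · intro x hx
        simp only [Finset.mem_singleton] at hx
        rcases hx with rfl | rfl | rfl <;> split_ifs <;> omega
  · rcases Nat.even_or_odd' s with ⟨m, rfl | rfl⟩
    -- The cycle s, s + 1, s + 2, hub has length 4, so the extra neighbour s + 2 does not shorten
    -- the odd closed walks at u.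
    · refine ⟨m, by omega, not_walk_of_level (fun x => if x ≤ 2 * m + 2 then (x - m) + (m - x)
        else if x ≤ 2 * q + 1 then min (x - m) (m + 3 + 2 * q - x) else m + 1)
        (q + 1) ?_ ?_ ?_ ho (by omega)⟩
      · split_ifs <;> omega
      · intro x hx
        split_ifs <;> omega
      · intro x hx
        simp only [Finset.mem_singleton, Finset.mem_insert] at hx
        rcases hx with rfl | rfl | rfl | rfl <;> split_ifs <;> omega
    · obtain ⟨r, rfl⟩ := Nat.exists_eq_add_of_le (show m + 1 ≤ q by omega)
      refine ⟨2 * m + 3 + r, by omega, not_walk_of_level (fun x => if x < 2 * m + 1 then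
        min (r + (2 * m + 3 - x)) (r + 2 + x) else if x ≤ 2 * (m + 1 + r) + 1 then
        (x - (2 * m + 3 + r)) + ((2 * m + 3 + r) - x) else r + 1)
        (m + r + 2) ?_ ?_ ?_ ho (by omega)⟩
      · split_ifs <;> omega
      · intro x hx
        split_ifs <;> omega
      · intro x hx
        simp only [Finset.mem_singleton, Finset.mem_insert] at hx
        rcases hx with rfl | rfl | rfl | rfl <;> split_ifs <;> omega

/-! ### Even path length -/

/-- Every edge joins vertices of opposite parity, the hub D + 1 being odd. -/
theorem Walk.parity_of_even (ho : D % 2 = 0) (hT : ∀ s ∈ T, s % 2 = 0) :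
    ∀ {k y : ℕ}, Walk D T k x y → (x + y + k) % 2 = 0
  | 0, y, h => by
    have := h.1
    omega
  | k + 1, y, ⟨z, h, e⟩ => by
    have h1 := h.parity_of_even ho hT
    rcases e with e | e | ⟨rfl, -, e | e | e⟩ | ⟨rfl, -, e | e | e⟩
    all_goals first
      | omega
      | (have := hT _ e; omega)

theorem exists_odd_mem (hD : 1 ≤ D) (ho : D % 2 = 0)
    (h : ∀ x ≤ D + 1, ∀ y ≤ D + 1, Walk D T k x y) : ∃ s ∈ T, s % 2 = 1 := by
  by_contra! hT
  have hT' : ∀ s ∈ T, s % 2 = 0 := fun s hs => by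
    have := hT s hs
    omega
  have h1 := (h 0 (by omega) 0 (by omega)).parity_of_even ho hT'
  have h2 := (h 0 (by omega) 1 (by omega)).parity_of_even ho hT'
  omega

/-- The edge from the hub to s splits the cycle of even length D + 2 into two odd cycles, which
supply the parity that the path lacks. -/
theorem walk_of_even (hD : 4 ≤ D) (ho : D % 2 = 0) (hT : T ⊆ Finset.Icc 1 (D - 1))
    (hs : s ∈ T) (hso : s % 2 = 1) (hx : x ≤ D + 1) (hy : y ≤ D + 1) :
    Walk D T D x y := by
  have h0 := isHubNeighbor_zero (D := D) (T := T)
  have h1 := isHubNeighbor_last (D := D) (T := T)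
  have hsn := isHubNeighbor_of_mem hT hs
  have hb := Finset.mem_Icc.1 (hT hs)
  have hD' : 1 ≤ D := by omega
  wlog hxy : x ≤ y generalizing x y
  · exact (this hy hx (by omega)).symm
  rcases Nat.lt_or_ge D y with h | h
  · obtain rfl : y = D + 1 := by omega
    rcases Nat.lt_or_ge D x with h' | h'
    · obtain rfl : x = D + 1 := by omega
      exact (walk_hub_hub h0 h0).extend hD' (by omega) (by omega)
    · rcases Nat.mod_two_eq_zero_or_one x with e | e
      · exact (walk_to_hub h' hsn).extend hD' (by omega) (by omega)
      · exact (walk_to_hub h' h0).extend hD' (by omega) (by omega)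
  have h' : x ≤ D := by omega
  by_cases e : (y - x) % 2 = 0
  · exact (walk_path h' h).extend hD' (by omega) (by omega)
  rcases Nat.lt_or_ge x s with c1 | c1
  · rcases Nat.lt_or_ge s y with c2 | c2
    · by_cases c3 : x + 2 + (y - s) ≤ D
      · exact (walk_through_hub h' h h0 hsn).extend hD' (by omega) (by omega)
      · exact (walk_through_hub h' h hsn h1).extend hD' (by omega) (by omega)
    · exact (walk_through_hub h' h h0 hsn).extend hD' (by omega) (by omega)
  · exact (walk_through_hub h' h hsn h1).extend hD' (by omega) (by omega)

theorem walk_pred_of_even_of_ne (hD : 6 ≤ D) (ho : D % 2 = 0) (hT : T ⊆ Finset.Icc 1 (D - 1))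
    (hs : s ∈ T) (hso : s % 2 = 1) (hx : x ≤ D + 1) (hy : y ≤ D + 1)
    (hne : x ≠ y ∨ x = D + 1) : Walk D T (D - 1) x y := by
  have h0 := isHubNeighbor_zero (D := D) (T := T)
  have h1 := isHubNeighbor_last (D := D) (T := T)
  have hsn := isHubNeighbor_of_mem hT hs
  have hb := Finset.mem_Icc.1 (hT hs)
  have hD' : 1 ≤ D := by omega
  wlog hxy : x ≤ y generalizing x y
  · exact (this hy hx (by omega) (by omega)).symm
  rcases Nat.lt_or_ge D y with h | h
  · obtain rfl : y = D + 1 := by omega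
    rcases Nat.lt_or_ge D x with h' | h'
    · obtain rfl : x = D + 1 := by omega
      by_cases c : s + 3 ≤ D
      · exact (walk_hub_hub h0 hsn).extend hD' (by omega) (by omega)
      · exact (walk_hub_hub h1 hsn).extend hD' (by omega) (by omega)
    · rcases Nat.mod_two_eq_zero_or_one x with e | e
      · by_cases c : x + 2 ≤ D
        · exact (walk_to_hub h' h0).extend hD' (by omega) (by omega)
        · exact (walk_to_hub h' h1).extend hD' (by omega) (by omega)
      · exact (walk_to_hub h' hsn).extend hD' (by omega) (by omega)
  have h' : x ≤ D := by omega
  by_cases e : (y - x) % 2 = 1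
  · exact (walk_path h' h).extend hD' (by omega) (by omega)
  rcases Nat.lt_or_ge x s with c1 | c1
  · rcases Nat.lt_or_ge s y with c2 | c2
    -- The two candidate lengths add up to D + 4, so if one is at least D the other is at most 4,
    -- which is where D ≥ 6 is needed.
    · by_cases c3 : x + 2 + (y - s) ≤ D - 1
      · exact (walk_through_hub h' h h0 hsn).extend hD' (by omega) (by omega)
      · exact (walk_through_hub h' h hsn h1).extend hD' (by omega) (by omega)
    · exact (walk_through_hub h' h h0 hsn).extend hD' (by omega) (by omega)
  · exact (walk_through_hub h' h hsn h1).extend hD' (by omega) (by omega)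

/-- The neighbourhoods of the hub that give the extremal exponent for even path length. -/
def evenExtremal (D : ℕ) : Finset (Finset ℕ) :=
  {{1}, {D - 1}, {1, D - 1}, {1, 2}, {D - 2, D - 1}, {1, 4}, {D - 4, D - 1}, {1, 2, 4},
    {D - 4, D - 2, D - 1}}

theorem card_evenExtremal (hD : 6 ≤ D) : (evenExtremal D).card = 9 := by
  unfold evenExtremal
  -- Six membership tests separate the nine sets, even for D = 6, where D - 4 = 2 and D - 2 = 4.
  have sep : ∀ A B : Finset ℕ, (¬ ((1 ∈ A ↔ 1 ∈ B) ∧ (2 ∈ A ↔ 2 ∈ B) ∧ (4 ∈ A ↔ 4 ∈ B) ∧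
      (D - 1 ∈ A ↔ D - 1 ∈ B) ∧ (D - 2 ∈ A ↔ D - 2 ∈ B) ∧ (D - 4 ∈ A ↔ D - 4 ∈ B))) → A ≠ B := by
    rintro A B h rfl
    simp at h
  iterate 8
    rw [Finset.card_insert_of_notMem]
    rotate_left
    · simp only [Finset.mem_insert, Finset.mem_singleton, not_or]
      repeat' apply And.intro
      all_goals
        apply sep
        simp [Finset.mem_insert, Finset.mem_singleton] <;> omega
  rw [Finset.card_singleton]

theorem mem_evenExtremal : T ∈ evenExtremal D ↔ T = {1} ∨ T = {D - 1} ∨ T = {1, D - 1} ∨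
    T = {1, 2} ∨ T = {D - 2, D - 1} ∨ T = {1, 4} ∨ T = {D - 4, D - 1} ∨ T = {1, 2, 4} ∨
    T = {D - 4, D - 2, D - 1} := by
  simp only [evenExtremal, Finset.mem_insert, Finset.mem_singleton]

theorem subset_and_exists_odd_of_mem_evenExtremal (hD : 6 ≤ D) (ho : D % 2 = 0)
    (hE : T ∈ evenExtremal D) : T ⊆ Finset.Icc 1 (D - 1) ∧ ∃ s ∈ T, s % 2 = 1 := by
  rw [mem_evenExtremal] at hE
  have h : 1 ∈ T ∨ D - 1 ∈ T := by
    rcases hE with rfl | rfl | rfl | rfl | rfl | rfl | rfl | rfl | rfl <;> simp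
  refine ⟨fun w hw => ?_, ?_⟩
  · rw [Finset.mem_Icc]
    rcases hE with rfl | rfl | rfl | rfl | rfl | rfl | rfl | rfl | rfl <;>
      simp only [Finset.mem_insert, Finset.mem_singleton] at hw <;> omega
  · rcases h with h | h
    · exact ⟨_, h, rfl⟩
    · exact ⟨_, h, by omega⟩

theorem walk_self_of_even (hD : 6 ≤ D) (ho : D % 2 = 0) (hT : T ⊆ Finset.Icc 1 (D - 1))
    (hs : s ∈ T) (hso : s % 2 = 1) (hE : T ∉ evenExtremal D) (h : u ≤ D) :
    Walk D T (D - 1) u u := by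
  have h0 := isHubNeighbor_zero (D := D) (T := T)
  have h1 := isHubNeighbor_last (D := D) (T := T)
  have hD' : 1 ≤ D := by omega
  have hb : ∀ s ∈ T, 1 ≤ s ∧ s ≤ D - 1 := fun s hs => Finset.mem_Icc.1 (hT hs)
  have hn : ∀ s ∈ T, IsHubNeighbor D T s := fun s hs => isHubNeighbor_of_mem hT hs
  rw [mem_evenExtremal] at hE
  push Not at hE
  obtain ⟨hE1, hE2, hE3, hE4, hE5, hE6, hE7, hE8, hE9⟩ := hE
  by_cases hc1 : ∃ r ∈ T, r % 2 = 1 ∧ r ≤ u ∧ 3 ≤ r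
  · obtain ⟨r, hr, e, hru, hr3⟩ := hc1
    have := hb r hr
    exact (walk_through_hub h h (hn r hr) h1).extend hD' (by omega) (by omega)
  by_cases hc2 : ∃ r ∈ T, r % 2 = 1 ∧ u ≤ r ∧ r + 3 ≤ D
  · obtain ⟨r, hr, e, hru, hr3⟩ := hc2
    have := hb r hr
    exact (walk_through_hub h h (hn r hr) h0).extend hD' (by omega) (by omega)
  push Not at hc1 hc2
  -- An odd r ≤ u yields length D - r + 2 via r and D, an odd r ≥ u yields r + 2 via r and 0; these
  -- exceed D - 1 only for r = 1 and r = D - 1.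
  have hodd : ∀ r ∈ T, r % 2 = 1 → (r = 1 ∧ 1 ≤ u) ∨ (r = D - 1 ∧ u ≤ D - 1) := by
    intro r hr e
    have q1 := hc1 r hr e
    have q2 := hc2 r hr e
    have := hb r hr
    omega
  have hTne : T.Nonempty := ⟨s, hs⟩
  by_cases m1 : 1 ∈ T
  · have hu1 : 1 ≤ u := by
      have := hodd 1 m1 rfl
      omega
    have n1 := hn 1 m1
    by_cases m2 : D - 1 ∈ T
    · have n2 := hn _ m2
      have hu2 : u ≤ D - 1 := by
        have := hodd _ m2 (by omega)
        omega
      obtain ⟨e, he, he1, he2⟩ : ∃ e ∈ T, e ≠ 1 ∧ e ≠ D - 1 := by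
        by_contra! hcon
        refine hE3 (Finset.ext fun w => ?_)
        rw [Finset.mem_insert, Finset.mem_singleton]
        refine ⟨fun hw => ?_, ?_⟩
        · have := hcon w hw
          omega
        · rintro (rfl | rfl) <;> assumption
      have hpe : e % 2 = 0 := by
        have := hodd e he
        omega
      have := hb e he
      rcases le_total u e with c | c
      · exact (walk_through_hub h h n1 (hn e he)).extend hD' (by omega) (by omega)
      · exact (walk_through_hub h h n2 (hn e he)).extend hD' (by omega) (by omega)
    · have heven : ∀ w ∈ T, w = 1 ∨ w % 2 = 0 := by
        intro w hw
        have := hodd w hw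
        have : w ≠ D - 1 := fun e => m2 (e ▸ hw)
        omega
      set e := T.max' hTne with he
      have heT : e ∈ T := T.max'_mem hTne
      have hle : ∀ w ∈ T, w ≤ e := fun w hw => T.le_max' w hw
      have hbe := hb e heT
      have he1 : e ≠ 1 := by
        intro he1
        refine hE1 (Finset.ext fun w => ?_)
        rw [Finset.mem_singleton]
        refine ⟨fun hw => ?_, ?_⟩
        · have := hle w hw
          have := hb w hw
          omega
        · rintro rfl
          assumption
      have hpe := heven e heT
      rcases le_total u e with c | c
      · exact (walk_through_hub h h n1 (hn e heT)).extend hD' (by omega) (by omega)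
      -- Past e, the triangle 0, 1, hub is reached via e or via D. If both are too long, then 2(u -
      -- e) and 2(D - u) are at least D - 4, which forces e ≤ 4.
      by_cases q1 : 2 * (u - e) + 5 ≤ D - 1
      · exact (walk_lollipop h (hn e heT) n1 h0).extend hD' (by omega) (by omega)
      by_cases q2 : 2 * (D - u) + 5 ≤ D - 1
      · exact (walk_lollipop h h1 n1 h0).extend hD' (by omega) (by omega)
      by_cases q3 : 2 * (u - e) + (e - 1) + 2 ≤ D - 1
      · exact (walk_through_hub h h (hn e heT) n1).extend hD' (by omega) (by omega)
      exfalso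
      rcases (by omega : e = 2 ∨ e = 4) with e2 | e4
      · refine hE4 (Finset.ext fun w => ?_)
        rw [Finset.mem_insert, Finset.mem_singleton]
        refine ⟨fun hw => ?_, ?_⟩
        · have := hle w hw
          have := hb w hw
          omega
        · rintro (rfl | rfl)
          · exact m1
          · exact e2 ▸ heT
      · by_cases m2' : 2 ∈ T
        · refine hE8 (Finset.ext fun w => ?_)
          rw [Finset.mem_insert, Finset.mem_insert, Finset.mem_singleton]
          refine ⟨fun hw => ?_, ?_⟩
          · have := hle w hw
            have := hb w hw
            have := heven w hw
            omega
          · rintro (rfl | rfl | rfl)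
            · exact m1
            · exact m2'
            · exact e4 ▸ heT
        · refine hE6 (Finset.ext fun w => ?_)
          rw [Finset.mem_insert, Finset.mem_singleton]
          refine ⟨fun hw => ?_, ?_⟩
          · have := hle w hw
            have := hb w hw
            have := heven w hw
            have : w ≠ 2 := fun e => m2' (e ▸ hw)
            omega
          · rintro (rfl | rfl)
            · exact m1
            · exact e4 ▸ heT
  · have m2 : D - 1 ∈ T := by
      rcases hodd s hs hso with ⟨e, -⟩ | ⟨e, -⟩
      · exact absurd (e ▸ hs) m1
      · exact e ▸ hs
    have n2 := hn _ m2
    have hu2 : u ≤ D - 1 := by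
      have := hodd _ m2 (by omega)
      omega
    have heven : ∀ w ∈ T, w = D - 1 ∨ w % 2 = 0 := by
      intro w hw
      have := hodd w hw
      have : w ≠ 1 := fun e => m1 (e ▸ hw)
      omega
    set e := T.min' hTne with he
    have heT : e ∈ T := T.min'_mem hTne
    have hle : ∀ w ∈ T, e ≤ w := fun w hw => T.min'_le w hw
    have hbe := hb e heT
    have he1 : e ≠ D - 1 := by
      intro he1
      refine hE2 (Finset.ext fun w => ?_)
      rw [Finset.mem_singleton]
      refine ⟨fun hw => ?_, ?_⟩
      · have := hle w hw
        have := hb w hw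
        omega
      · rintro rfl
        assumption
    have hpe := heven e heT
    rcases le_total e u with c | c
    · exact (walk_through_hub h h n2 (hn e heT)).extend hD' (by omega) (by omega)
    -- The mirror image, with the triangle D - 1, D, hub.
    by_cases q1 : 2 * (e - u) + 5 ≤ D - 1
    · exact (walk_lollipop h (hn e heT) n2 h1).extend hD' (by omega) (by omega)
    by_cases q2 : 2 * u + 5 ≤ D - 1
    · exact (walk_lollipop h h0 n2 h1).extend hD' (by omega) (by omega)
    by_cases q3 : 2 * (e - u) + (D - 1 - e) + 2 ≤ D - 1
    · exact (walk_through_hub h h (hn e heT) n2).extend hD' (by omega) (by omega)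
    exfalso
    rcases (by omega : e = D - 2 ∨ e = D - 4) with e2 | e4
    · refine hE5 (Finset.ext fun w => ?_)
      rw [Finset.mem_insert, Finset.mem_singleton]
      refine ⟨fun hw => ?_, ?_⟩
      · have := hle w hw
        have := hb w hw
        omega
      · rintro (rfl | rfl)
        · exact e2 ▸ heT
        · exact m2
    · by_cases m2' : D - 2 ∈ T
      · refine hE9 (Finset.ext fun w => ?_)
        rw [Finset.mem_insert, Finset.mem_insert, Finset.mem_singleton]
        refine ⟨fun hw => ?_, ?_⟩
        · have := hle w hw
          have := hb w hw
          have := heven w hw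
          omega
        · rintro (rfl | rfl | rfl)
          · exact e4 ▸ heT
          · exact m2'
          · exact m2
      · refine hE7 (Finset.ext fun w => ?_)
        rw [Finset.mem_insert, Finset.mem_singleton]
        refine ⟨fun hw => ?_, ?_⟩
        · have := hle w hw
          have := hb w hw
          have := heven w hw
          have : w ≠ D - 2 := fun e => m2' (e ▸ hw)
          omega
        · rintro (rfl | rfl)
          · exact e4 ▸ heT
          · exact m2

theorem exists_not_walk_of_even (hD : 6 ≤ D) (ho : D % 2 = 0) (hE : T ∈ evenExtremal D) :
    ∃ u ≤ D + 1, ¬ Walk D T (D - 1) u u := by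
  obtain ⟨m, rfl⟩ : ∃ m, D = 2 * m := ⟨D / 2, by omega⟩
  rw [mem_evenExtremal] at hE
  have hk : (2 * m - 1) % 2 = 1 := by omega
  have hcenter : (∀ x ∈ T, x = 1 ∨ x = 2 * m - 1) → ∃ u ≤ 2 * m + 1,
      ¬ Walk (2 * m) T (2 * m - 1) u u := fun hT => by
    refine ⟨m, by omega, not_walk_of_level
      (fun x => if x ≤ 2 * m then (x - m) + (m - x) else m) m ?_ ?_ ?_ hk (by omega)⟩
    · split_ifs <;> omega
    · intro x hx
      split_ifs <;> omega
    · intro x hx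
      have := hx.imp_right (Or.imp_right (hT x))
      split_ifs <;> omega
  have hleft : (∀ x ∈ T, x = 1 ∨ x = 2 ∨ x = 4) → ∃ u ≤ 2 * m + 1,
      ¬ Walk (2 * m) T (2 * m - 1) u u := fun hT => by
    -- The vertices 0, 1, 2 all get height m, so the level edges are those between them; the hub has
    -- height m - 1, via D.
    refine ⟨m + 2, by omega, not_walk_of_level (fun x => if x ≤ 1 then m else if x ≤ 2 * m then
      (x - (m + 2)) + (m + 2 - x) else m - 1) m ?_ ?_ ?_ hk (by omega)⟩
    · split_ifs <;> omega
    · intro x hx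
      split_ifs <;> omega
    · intro x hx
      have := hx.imp_right (Or.imp_right (hT x))
      split_ifs <;> omega
  have hright : (∀ x ∈ T, x = 2 * m - 1 ∨ x = 2 * m - 2 ∨ x = 2 * m - 4) → ∃ u ≤ 2 * m + 1,
      ¬ Walk (2 * m) T (2 * m - 1) u u := fun hT => by
    refine ⟨m - 2, by omega, not_walk_of_level (fun x => if x ≤ 2 * m then
      (if 2 * m - 1 ≤ x then m else (x - (m - 2)) + (m - 2 - x)) else m - 1) m ?_ ?_ ?_ hk
      (by omega)⟩
    · split_ifs <;> omega
    · intro x hx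
      split_ifs <;> omega
    · intro x hx
      have := hx.imp_right (Or.imp_right (hT x))
      split_ifs <;> omega
  have hleft2 : (∀ x ∈ T, x = 1 ∨ x = 2) → ∃ u ≤ 2 * m + 1,
      ¬ Walk (2 * m) T (2 * m - 1) u u := fun hT => by
    refine ⟨m + 1, by omega, not_walk_of_level (fun x => if x ≤ 2 * m then
      (x - (m + 1)) + (m + 1 - x) else m) m ?_ ?_ ?_ hk (by omega)⟩
    · split_ifs <;> omega
    · intro x hx
      split_ifs <;> omega
    · intro x hx
      have := hx.imp_right (Or.imp_right (hT x))
      split_ifs <;> omega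
  have hright2 : (∀ x ∈ T, x = 2 * m - 1 ∨ x = 2 * m - 2) → ∃ u ≤ 2 * m + 1,
      ¬ Walk (2 * m) T (2 * m - 1) u u := fun hT => by
    refine ⟨m - 1, by omega, not_walk_of_level (fun x => if x ≤ 2 * m then
      (x - (m - 1)) + (m - 1 - x) else m) m ?_ ?_ ?_ hk (by omega)⟩
    · split_ifs <;> omega
    · intro x hx
      split_ifs <;> omega
    · intro x hx
      have := hx.imp_right (Or.imp_right (hT x))
      split_ifs <;> omega
  rcases hE with rfl | rfl | rfl | rfl | rfl | rfl | rfl | rfl | rfl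
  · exact hcenter (by simp)
  · exact hcenter (by simp)
  · exact hcenter (by simp)
  · exact hleft2 (by simp)
  · exact hright2 (by simp)
  · exact hleft (by simp)
  · exact hright (by simp)
  · exact hleft (by simp)
  · exact hright (by simp)

/-! ### From matrices to walks -/

/-- The last row of a companion matrix: ones at `0`, on `T`, and, if `c` holds, at `D`. -/
noncomputable def lastRow (D : ℕ) (T : Finset ℕ) (c : Bool) (j : Fin (D + 2)) : ℝ :=
  if (j : ℕ) = 0 ∨ (j : ℕ) ∈ T ∨ (c = true ∧ (j : ℕ) = D) then 1 else 0

/-- The symmetric companion matrix with last row `lastRow D T c`. -/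
noncomputable def fanMatrix (D : ℕ) (T : Finset ℕ) (c : Bool) :
    Matrix (Fin (D + 2)) (Fin (D + 2)) ℝ :=
  symmetrization (companion (lastRow D T c))

theorem companion_lastRow_nonneg (c : Bool) (i j : Fin (D + 2)) :
    0 ≤ companion (lastRow D T c) i j := by
  simp only [companion, lastRow, Matrix.of_apply]
  split_ifs <;> norm_num

theorem companion_lastRow_pos (c : Bool) (i j : Fin (D + 2)) :
    0 < companion (lastRow D T c) i j ↔
      ((i : ℕ) = D + 1 ∧ ((j : ℕ) = 0 ∨ (j : ℕ) ∈ T ∨ (c = true ∧ (j : ℕ) = D))) ∨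
      (i : ℕ) ≠ D + 1 ∧ (j : ℕ) = i + 1 := by
  simp only [companion, lastRow, Matrix.of_apply]
  split_ifs with h1 h2 h2
  · simp only [zero_lt_one, true_iff]
    exact Or.inl ⟨by omega, h2⟩
  · simp only [lt_irrefl, false_iff]
    rintro (⟨-, h⟩ | ⟨h, -⟩)
    · exact h2 h
    · omega
  · simp only [zero_lt_one, true_iff]
    omega
  · simp only [lt_irrefl, false_iff]
    omega

theorem fanMatrix_nonneg (c : Bool) (i j : Fin (D + 2)) : 0 ≤ fanMatrix D T c i j :=
  add_nonneg (companion_lastRow_nonneg c i j) (companion_lastRow_nonneg c j i)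

/-- The bit c plays no role, because the superdiagonal already joins D to the hub. -/
theorem fanMatrix_pos_iff (hT : T ⊆ Finset.Icc 1 (D - 1)) (c : Bool) (i j : Fin (D + 2)) :
    0 < fanMatrix D T c i j ↔ Adj D T i j := by
  have h1 := companion_lastRow_nonneg (T := T) c i j
  have h2 := companion_lastRow_nonneg (T := T) c j i
  have h3 : 0 < fanMatrix D T c i j ↔
      0 < companion (lastRow D T c) i j ∨ 0 < companion (lastRow D T c) j i := by
    change 0 < companion (lastRow D T c) i j + companion (lastRow D T c) j i ↔ _
    constructor
    · intro h
      by_contra! hcon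
      linarith
    · rintro (h | h) <;> linarith
  rw [h3, companion_lastRow_pos, companion_lastRow_pos]
  unfold Adj
  have hi := i.2
  have hj := j.2
  have e1 : (i : ℕ) ∈ T → 1 ≤ (i : ℕ) ∧ (i : ℕ) ≤ D - 1 := fun h => Finset.mem_Icc.1 (hT h)
  have e2 : (j : ℕ) ∈ T → 1 ≤ (j : ℕ) ∧ (j : ℕ) ≤ D - 1 := fun h => Finset.mem_Icc.1 (hT h)
  by_cases m1 : (i : ℕ) ∈ T <;> by_cases m2 : (j : ℕ) ∈ T <;> simp only [m1, m2, true_imp_iff,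
    true_or, or_true, and_true, false_or, or_false] at e1 e2 ⊢ <;> omega

theorem fanMatrix_pow_nonneg (c : Bool) (k : ℕ) (i j : Fin (D + 2)) :
    0 ≤ (fanMatrix D T c ^ k) i j := by
  induction k generalizing j with
  | zero =>
    rw [pow_zero, Matrix.one_apply]
    split_ifs <;> norm_num
  | succ k ih =>
    rw [pow_succ, Matrix.mul_apply]
    exact Finset.sum_nonneg fun l _ => mul_nonneg (ih l) (fanMatrix_nonneg c l j)

theorem fanMatrix_pow_pos_iff (hT : T ⊆ Finset.Icc 1 (D - 1)) (c : Bool) (k : ℕ)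
    (i j : Fin (D + 2)) : 0 < (fanMatrix D T c ^ k) i j ↔ Walk D T k i j := by
  induction k generalizing j with
  | zero =>
    rw [pow_zero, Matrix.one_apply]
    simp only [Walk]
    split_ifs with h
    · simp [h]
      omega
    · simp [Fin.ext_iff] at h
      simp [h]
  | succ k ih =>
    rw [pow_succ, Matrix.mul_apply, Finset.sum_pos_iff_of_nonneg fun l _ =>
      mul_nonneg (fanMatrix_pow_nonneg c k i l) (fanMatrix_nonneg c l j)]
    constructor
    · rintro ⟨l, -, hl⟩
      have h1 := (pos_iff_pos_of_mul_pos hl)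
      have h2 : 0 < (fanMatrix D T c ^ k) i l :=
        lt_of_le_of_ne (fanMatrix_pow_nonneg c k i l) fun e => by simp [← e] at hl
      exact ⟨l, (ih l).1 h2, (fanMatrix_pos_iff hT c l j).1 (h1.1 h2)⟩
    · rintro ⟨z, h1, h2⟩
      have hz := h1.le_right
      let l : Fin (D + 2) := ⟨z, by omega⟩
      exact ⟨l, Finset.mem_univ _, mul_pos ((ih l).2 h1) ((fanMatrix_pos_iff hT c l j).2 h2)⟩

theorem fanMatrix_pow_pos_iff_forall (hT : T ⊆ Finset.Icc 1 (D - 1)) (c : Bool) (k : ℕ) :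
    (∀ i j, 0 < (fanMatrix D T c ^ k) i j) ↔ ∀ x ≤ D + 1, ∀ y ≤ D + 1, Walk D T k x y := by
  constructor
  · intro h x hx y hy
    exact (fanMatrix_pow_pos_iff hT c k ⟨x, by omega⟩ ⟨y, by omega⟩).1 (h _ _)
  · intro h i j
    exact (fanMatrix_pow_pos_iff hT c k i j).2 (h i (by omega) j (by omega))

/-! ### Primitivity and exponents in terms of walks -/

theorem forall_walk_mono (hD : 1 ≤ D) (h : ∀ x ≤ D + 1, ∀ y ≤ D + 1, Walk D T k x y)
    (hkl : k ≤ l) : ∀ x ≤ D + 1, ∀ y ≤ D + 1, Walk D T l x y := by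
  induction hkl with
  | refl => exact h
  | step _ ih =>
    intro x hx y hy
    obtain ⟨z, hz⟩ := exists_adj (T := T) hD hy
    exact ⟨z, ih x hx z hz.le_left, hz⟩

theorem isPrimitive_fanMatrix_iff (hT : T ⊆ Finset.Icc 1 (D - 1)) (c : Bool) :
    (fanMatrix D T c).IsPrimitive ↔
      ∃ k, 0 < k ∧ ∀ x ≤ D + 1, ∀ y ≤ D + 1, Walk D T k x y := by
  rw [Matrix.isPrimitive_iff]
  simp only [fanMatrix_pow_pos_iff_forall hT]
  exact and_iff_right fun i j => fanMatrix_nonneg c i j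

theorem primitiveExponent_fanMatrix_le (hT : T ⊆ Finset.Icc 1 (D - 1)) (c : Bool) (hk : 0 < k)
    (h : ∀ x ≤ D + 1, ∀ y ≤ D + 1, Walk D T k x y) :
    primitiveExponent (fanMatrix D T c) ≤ k :=
  Nat.sInf_le ⟨hk, (fanMatrix_pow_pos_iff_forall hT c k).2 h⟩

/-- Positivity of all entries passes to higher powers, so failure at k - 1 rules out every smaller
exponent. -/
theorem primitiveExponent_fanMatrix_eq_iff (hD : 1 ≤ D) (hT : T ⊆ Finset.Icc 1 (D - 1)) (c : Bool)
    (hk : 2 ≤ k) (h : ∀ x ≤ D + 1, ∀ y ≤ D + 1, Walk D T k x y) :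
    primitiveExponent (fanMatrix D T c) = k ↔
      ¬ ∀ x ≤ D + 1, ∀ y ≤ D + 1, Walk D T (k - 1) x y := by
  have hle := primitiveExponent_fanMatrix_le hT c (by omega) h
  constructor
  · intro he h'
    have := primitiveExponent_fanMatrix_le hT c (by omega) h'
    omega
  · intro h'
    refine le_antisymm hle ?_
    by_contra! hlt
    refine h' (forall_walk_mono hD ?_ (Nat.le_sub_one_of_lt hlt))
    rw [← fanMatrix_pow_pos_iff_forall hT c]
    exact (Nat.sInf_mem (s := {k | 0 < k ∧ ∀ i j, 0 < (fanMatrix D T c ^ k) i j})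
      ⟨k, by omega, (fanMatrix_pow_pos_iff_forall hT c k).2 h⟩).2

/-! ### Parametrization of the matrices by T and c -/

theorem lastRow_zero_or_one (c : Bool) (j : Fin (D + 2)) :
    lastRow D T c j = 0 ∨ lastRow D T c j = 1 := by
  unfold lastRow
  split_ifs <;> simp

theorem mem_symmCompanion_iff (hD : 1 ≤ D) (B : Matrix (Fin (D + 2)) (Fin (D + 2)) ℝ) :
    B ∈ symmCompanion (D + 2) 1 0 ↔ ∃ T ⊆ Finset.Icc 1 (D - 1), ∃ c, B = fanMatrix D T c := by
  constructor
  · rintro ⟨A, ⟨a, ha, rfl⟩, h1, h0, rfl⟩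
    have a0 : a 0 = 1 := by
      simpa [companion] using h1 (Fin.last (D + 1)) 0 (by simp) rfl
    have a1 : a (Fin.last (D + 1)) = 0 := by
      simpa [companion] using h0 (Fin.last (D + 1)) (by simp)
    classical
    refine ⟨(Finset.Icc 1 (D - 1)).filter (fun j => ∃ h : j < D + 2, a ⟨j, h⟩ = 1),
      Finset.filter_subset _ _, decide (a ⟨D, by omega⟩ = 1), ?_⟩
    unfold fanMatrix
    congr 2
    funext j
    unfold lastRow
    have hj := j.2
    have key : ((j : ℕ) = 0 ∨ (j : ℕ) ∈ (Finset.Icc 1 (D - 1)).filter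
        (fun j => ∃ h : j < D + 2, a ⟨j, h⟩ = 1) ∨
        (decide (a ⟨D, by omega⟩ = 1) = true ∧ (j : ℕ) = D)) ↔ a j = 1 := by
      simp only [Finset.mem_filter, Finset.mem_Icc, Fin.eta, decide_eq_true_eq]
      rcases (by omega : (j : ℕ) = 0 ∨ (j : ℕ) = D ∨ (j : ℕ) = D + 1 ∨
        (1 ≤ (j : ℕ) ∧ (j : ℕ) ≤ D - 1)) with h | h | h | h
      · have : j = 0 := Fin.ext h
        simp [this, a0]
      · have : (⟨D, by omega⟩ : Fin (D + 2)) = j := Fin.ext h.symm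
        have e1 : D ≠ 0 := by omega
        have e2 : ¬ (1 ≤ D ∧ D ≤ D - 1) := by omega
        rw [this]
        simp only [e1, e2, h, false_and, false_or, and_true]
      · have : j = Fin.last (D + 1) := Fin.ext h
        subst this
        simp [a1]
      · have e1 : (j : ℕ) ≠ 0 := by omega
        have e2 : (j : ℕ) ≠ D := by omega
        simp only [e1, e2, h, false_or, and_false, or_false, true_and, and_true, hj,
          exists_true_left]
    rw [if_congr key rfl rfl]
    rcases ha j with h | h <;> simp [h]
  · rintro ⟨T, hT, c, rfl⟩
    refine ⟨_, ⟨lastRow D T c, lastRow_zero_or_one c, rfl⟩, ?_, ?_, rfl⟩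
    · intro i j hi hj
      simp only [companion, lastRow, Matrix.of_apply, hi, hj, if_true, true_or]
    · intro i hi
      have : (i : ℕ) ∉ T := fun h => by
        have := Finset.mem_Icc.1 (hT h)
        omega
      simp only [companion, lastRow, hi, Matrix.of_apply, if_true, this, false_or]
      rw [if_neg]
      omega

theorem fanMatrix_last (c : Bool) (j : Fin (D + 2)) (hj : (j : ℕ) ≤ D) :
    fanMatrix D T c (Fin.last (D + 1)) j = lastRow D T c j + if (j : ℕ) = D then 1 else 0 := by
  have h1 : (j : ℕ) ≠ D + 1 := by omega
  simp [fanMatrix, symmetrization, companion, h1, eq_comm]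

theorem fanMatrix_injective {T' : Finset ℕ} {c c' : Bool} (hD : 1 ≤ D)
    (hT : T ⊆ Finset.Icc 1 (D - 1)) (hT' : T' ⊆ Finset.Icc 1 (D - 1))
    (h : fanMatrix D T c = fanMatrix D T' c') : T = T' ∧ c = c' := by
  have key : ∀ j : Fin (D + 2), (j : ℕ) ≤ D → lastRow D T c j = lastRow D T' c' j := by
    intro j hj
    have := congrFun (congrFun h (Fin.last (D + 1))) j
    rw [fanMatrix_last c j hj, fanMatrix_last c' j hj] at this
    exact add_right_cancel this
  have key' : ∀ x ≤ D, (x = 0 ∨ x ∈ T ∨ (c = true ∧ x = D)) ↔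
      (x = 0 ∨ x ∈ T' ∨ (c' = true ∧ x = D)) := by
    intro x hx
    have := key ⟨x, by omega⟩ hx
    simp only [lastRow] at this
    split_ifs at this with h1 h2 h2
    · exact iff_of_true h1 h2
    · norm_num at this
    · norm_num at this
    · exact iff_of_false h1 h2
  have bd : ∀ {S : Finset ℕ}, S ⊆ Finset.Icc 1 (D - 1) → ∀ x ∈ S, x ≠ 0 ∧ x < D :=
    fun hS x hx => by
      have := Finset.mem_Icc.1 (hS hx)
      omega
  refine ⟨Finset.ext fun x => ⟨fun hx => ?_, fun hx => ?_⟩, ?_⟩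
  · have b := bd hT x hx
    rcases (key' x b.2.le).1 (by simp [hx]) with e | e | ⟨-, e⟩
    · exact absurd e b.1
    · exact e
    · exact absurd e b.2.ne
  · have b := bd hT' x hx
    rcases (key' x b.2.le).2 (by simp [hx]) with e | e | ⟨-, e⟩
    · exact absurd e b.1
    · exact e
    · exact absurd e b.2.ne
  · have n1 : D ∉ T := fun h => (bd hT D h).2.ne rfl
    have n2 : D ∉ T' := fun h => (bd hT' D h).2.ne rfl
    have := key' D le_rfl
    have hD0 : D ≠ 0 := by omega
    simp only [hD0, n1, n2, false_or, and_true] at this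
    exact Bool.eq_iff_iff.2 this

/-- The exponent problem for symmetric companion matrices, in terms of walks. -/
theorem isGreatest_and_numWithExponent {b : ℕ} (hD : 1 ≤ D) (hb : 2 ≤ b)
    (L : Finset (Finset ℕ)) (hne : L.Nonempty)
    (hL : ∀ T ∈ L, T ⊆ Finset.Icc 1 (D - 1) ∧ ∀ x ≤ D + 1, ∀ y ≤ D + 1, Walk D T b x y)
    (hwalk : ∀ T ⊆ Finset.Icc 1 (D - 1),
      (∃ k, 0 < k ∧ ∀ x ≤ D + 1, ∀ y ≤ D + 1, Walk D T k x y) →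
      (∀ x ≤ D + 1, ∀ y ≤ D + 1, Walk D T b x y) ∧
      ((¬ ∀ x ≤ D + 1, ∀ y ≤ D + 1, Walk D T (b - 1) x y) ↔ T ∈ L)) :
    IsGreatest (exponentSet (primSymmCompanion (D + 2) 1 0)) b ∧
      numWithExponent (D + 2) 1 0 b = 2 * L.card := by
  have hmem : ∀ T ∈ L, ∀ c, fanMatrix D T c ∈ primSymmCompanion (D + 2) 1 0 ∧
      primitiveExponent (fanMatrix D T c) = b := by
    intro T hT c
    obtain ⟨hT', hw⟩ := hL T hT
    have hp : ∃ k, 0 < k ∧ ∀ x ≤ D + 1, ∀ y ≤ D + 1, Walk D T k x y := ⟨b, by omega, hw⟩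
    exact ⟨⟨(mem_symmCompanion_iff hD _).2 ⟨T, hT', c, rfl⟩,
      (isPrimitive_fanMatrix_iff hT' c).2 hp⟩,
      (primitiveExponent_fanMatrix_eq_iff hD hT' c hb hw).2 ((hwalk T hT' hp).2.2 hT)⟩
  refine ⟨⟨?_, ?_⟩, ?_⟩
  · obtain ⟨T, hT⟩ := hne
    have := hmem T hT true
    exact ⟨_, this.1, this.1.2, this.2⟩
  · rintro k ⟨A, ⟨hA, -⟩, hp, rfl⟩
    obtain ⟨T, hT, c, rfl⟩ := (mem_symmCompanion_iff hD A).1 hA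
    exact primitiveExponent_fanMatrix_le hT c (by omega)
      (hwalk T hT ((isPrimitive_fanMatrix_iff hT c).1 hp)).1
  · have himage : {A | A ∈ primSymmCompanion (D + 2) 1 0 ∧ primitiveExponent A = b} =
        (fun q : Finset ℕ × Bool => fanMatrix D q.1 q.2) ''
          ((L ×ˢ Finset.univ : Finset (Finset ℕ × Bool)) : Set (Finset ℕ × Bool)) := by
      ext A
      constructor
      · rintro ⟨⟨hA, hp⟩, he⟩
        obtain ⟨T, hT, c, rfl⟩ := (mem_symmCompanion_iff hD A).1 hA
        have hw := hwalk T hT ((isPrimitive_fanMatrix_iff hT c).1 hp)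
        refine ⟨(T, c), ?_, rfl⟩
        simpa using hw.2.1 ((primitiveExponent_fanMatrix_eq_iff hD hT c hb hw.1).1 he)
      · rintro ⟨⟨T, c⟩, hT, rfl⟩
        exact hmem T (by simpa using hT) c
    rw [numWithExponent, himage, Set.InjOn.ncard_image, Set.ncard_coe_finset,
      Finset.card_product]
    · simp [mul_comm]
    · rintro ⟨T, c⟩ h ⟨T', c'⟩ h' e
      have h1 : T ∈ L := by simpa using h
      have h2 : T' ∈ L := by simpa using h'
      obtain ⟨rfl, rfl⟩ := fanMatrix_injective hD (hL T h1).1 (hL T' h2).1 e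
      rfl

end SymmCompanion

/-! ### Assembly of the two parities -/

theorem theorem7 (n b : ℕ) (hb : IsGreatest (SymmCompanion.evenInterval 2 (n - 1)) b) :
    (5 ≤ n → Odd n →
      IsGreatest (SymmCompanion.exponentSet (SymmCompanion.primSymmCompanion n 1 0)) b ∧
      SymmCompanion.numWithExponent n 1 0 b = 2 * (2 * n - 7)) ∧
    (8 ≤ n → Even n →
      IsGreatest (SymmCompanion.exponentSet (SymmCompanion.primSymmCompanion n 1 0)) b ∧
      SymmCompanion.numWithExponent n 1 0 b = 18) := by
  obtain ⟨⟨hb2, hbn, hbe⟩, hmax⟩ := hb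
  rw [Nat.even_iff] at hbe
  constructor
  · intro hn ho
    rw [Nat.odd_iff] at ho
    obtain ⟨D, rfl⟩ : ∃ D, n = D + 2 := ⟨n - 2, by omega⟩
    have hbD : b = D + 1 := by
      have : D + 1 ≤ b := hmax ⟨by omega, by omega, Nat.even_iff.2 (by omega)⟩
      omega
    subst hbD
    have hw : ∀ T : Finset ℕ, ∀ x ≤ D + 1, ∀ y ≤ D + 1, SymmCompanion.Walk D T (D + 1) x y :=
      fun T x hx y hy => SymmCompanion.walk_succ_of_odd (by omega) (by omega) hx hy
    have := SymmCompanion.isGreatest_and_numWithExponent (D := D) (b := D + 1) (by omega)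
      (by omega) (SymmCompanion.oddExtremal D) ⟨∅, by simp [SymmCompanion.mem_oddExtremal]⟩
      (fun T hT => ⟨?_, hw T⟩) (fun T hT _ => ⟨hw T, ?_⟩)
    · rw [SymmCompanion.card_oddExtremal (by omega)] at this
      refine ⟨this.1, this.2.trans ?_⟩
      omega
    · rw [SymmCompanion.mem_oddExtremal] at hT
      intro w hw
      rw [Finset.mem_Icc]
      rcases hT with rfl | ⟨s, h1, h2, rfl⟩ | ⟨s, h1, h2, rfl⟩ <;>
        simp at hw <;> omega
    · rw [Nat.add_sub_cancel]
      refine ⟨fun h => ?_, fun h h' => ?_⟩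
      · by_contra hE
        refine h fun x hx y hy => ?_
        by_cases hxy : x = y
        · exact hxy ▸ SymmCompanion.walk_self_of_odd hT (by omega) (by omega) hE hx
        · exact SymmCompanion.walk_of_odd_of_ne (by omega) (by omega) hx hy hxy
      · obtain ⟨u, hu, hnot⟩ :=
          SymmCompanion.exists_not_walk_of_odd (by omega) (by omega) h
        exact hnot (h' u hu u hu)
  · intro hn ho
    rw [Nat.even_iff] at ho
    obtain ⟨D, rfl⟩ : ∃ D, n = D + 2 := ⟨n - 2, by omega⟩
    have hbD : b = D := by
      have : D ≤ b := hmax ⟨by omega, by omega, Nat.even_iff.2 (by omega)⟩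
      omega
    subst hbD
    have hD : 6 ≤ b := by omega
    have := SymmCompanion.isGreatest_and_numWithExponent (D := b) (b := b) (by omega)
      (by omega) (SymmCompanion.evenExtremal b) ⟨{1}, by simp [SymmCompanion.mem_evenExtremal]⟩
      (fun T hT => ?_) (fun T hT hp => ?_)
    · rw [SymmCompanion.card_evenExtremal (by omega)] at this
      exact this
    · obtain ⟨h, s, hs, hso⟩ :=
        SymmCompanion.subset_and_exists_odd_of_mem_evenExtremal hD hbe hT
      exact ⟨h, fun x hx y hy => SymmCompanion.walk_of_even (by omega) hbe h hs hso hx hy⟩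
    · obtain ⟨k, -, hk⟩ := hp
      obtain ⟨s, hs, hso⟩ := SymmCompanion.exists_odd_mem (by omega) hbe hk
      refine ⟨fun x hx y hy => SymmCompanion.walk_of_even (by omega) hbe hT hs hso hx hy,
        fun h => ?_, fun h h' => ?_⟩
      · by_contra hE
        refine h fun x hx y hy => ?_
        by_cases hxy : x ≠ y ∨ x = b + 1
        · exact SymmCompanion.walk_pred_of_even_of_ne hD hbe hT hs hso hx hy hxy
        · obtain rfl : x = y := by omega
          exact SymmCompanion.walk_self_of_even hD hbe hT hs hso hE (by omega)
      · obtain ⟨u, hu, hnot⟩ := SymmCompanion.exists_not_walk_of_even hD hbe h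
        exact hnot (h' u hu u hu)
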